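/- Let $n\ge 0$ and let $I$ be an ideal in the ring $\mathbb C[[z_1,\dots,z_n]]$ of formal power series. Suppose that the complex vector space $\mathbb C[[z_1,\dots,z_n]]/I$ has infinite dimension. Then there is a nonconstant formal curve through the origin, i.e. an $n$-tuple $\zeta(t)=(\zeta_1(t),\dots,\zeta_n(t))$ of formal power series $\zeta_j\in\mathbb C[[t]]$ with $\zeta(0)=0$ and not all $\zeta_j$ constant, such that for every $f\in I$ the formal power series $f\circ\zeta = f(\zeta_1(t),\dots,\zeta_n(t))\in\mathbb C[[t]]$ vanishes to infinite order at $t=0$, i.e. all of its coefficients are zero. -/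

import Mathlib

/-- A formal curve in `ℂⁿ`: an `n`-tuple of formal power series in one complex variable `t`. -/
abbrev FormalCurve (n : ℕ) : Type := Fin n → PowerSeries ℂ

namespace FormalCurve

/-- The formal curve passes through `p`, i.e. `ζ(0) = p`. -/
def PassesThrough {n : ℕ} (ζ : FormalCurve n) (p : Fin n → ℂ) : Prop :=
  ∀ j, PowerSeries.constantCoeff (ζ j) = p j

/-- The formal curve is constant: each component is a constant power series. -/
def IsConstant {n : ℕ} (ζ : FormalCurve n) : Prop :=
  ∃ p : Fin n → ℂ, ∀ j, ζ j = PowerSeries.C (p j)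

/-- The pull-back `f ∘ ζ`, a formal power series in `t`, obtained by substituting `ζ j` for the
variable `z_j`. It is only meaningful for curves through the origin. -/
noncomputable def pullback {n : ℕ} (ζ : FormalCurve n) (f : MvPowerSeries (Fin n) ℂ) :
    PowerSeries ℂ :=
  MvPowerSeries.subst (τ := Unit) (S := ℂ) ζ f

end FormalCurve

/-!
Enlarge `I` to an ideal `P` that is maximal among the ideals of infinite codimension in
`R = ℂ⟦z₁, …, zₙ⟧`, which is possible because `R` is Noetherian. Such a `P` is prime
(`Ideal.exists_isPrime_maximal_infinite_quotient`), so `A = R ⧸ P` is a local domain in which every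
nonzero ideal has finite codimension: geometrically, the ring of an irreducible formal curve. The
theorem follows by parametrizing one branch of this curve.

Choose a nonzero `t` in the maximal ideal of `A`. Then `A` is finite over `ℂ⟦X⟧` with `X` acting as
`t` (`PowerSeries.finite_of_finite_quotient_X`), and the integral closure of `ℂ⟦X⟧` in the fraction
field of `A` is a Dedekind domain containing `A`. Localizing it at a maximal ideal gives a discrete
valuation ring with residue field `ℂ`, whose elements have power series expansions in a uniformizer
(`PowerSeries.exists_algHom_of_ker_eq_span`). The composite `ψ : R → A → ℂ⟦X⟧` vanishes on `I` but
not on `t`.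

It remains to see that `ψ` is the pull-back along the curve `ζ j = ψ (z j)`. Every `ℂ`-algebra
homomorphism `R → ℂ⟦X⟧` is local (`MvPowerSeries.constantCoeff_algHom_apply`), hence determined by
the images of the variables (`MvPowerSeries.algHom_powerSeries_ext`). The curve is not constant
since otherwise `ψ` would send `t` to `0`.
-/

/-! ### Formal expansions -/

open PowerSeries in
/-- Expansion in powers of `π`: if `V` is a `k`-algebra with an augmentation `c` whose kernel is
generated by `π`, every `v` has a `π`-adic expansion with coefficients in `k`. Writing
`v = c v + π * S v`, the `n`-th coefficient is `c (S^[n] v)`. -/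
theorem PowerSeries.exists_algHom_of_ker_eq_span {k V : Type*} [Field k] [CommRing V]
    [IsDomain V] [Algebra k V] (c : V →ₐ[k] k) {π : V} (hπ : π ≠ 0) (hc : RingHom.ker c = Ideal.span {π}) :
    ∃ F : V →ₐ[k] k⟦X⟧, F π = X := by
  have hS : ∀ v, ∃ w, v = algebraMap k V (c v) + π * w := by
    intro v
    have hv : v - algebraMap k V (c v) ∈ Ideal.span {π} := by
      rw [← hc, RingHom.mem_ker]; simp
    obtain ⟨w, hw⟩ := Ideal.mem_span_singleton.1 hv
    exact ⟨w, by rw [← hw]; ring⟩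
  choose S hS using hS
  have hcπ : c π = 0 := by
    rw [← RingHom.mem_ker, hc]; exact Ideal.mem_span_singleton_self π
  have S_eq : ∀ v w a, v = algebraMap k V a + π * w → S v = w := by
    intro v w a h
    have ha : c v = a := by rw [h]; simp [hcπ]
    have h' := hS v
    rw [ha] at h'
    exact mul_left_cancel₀ hπ (add_left_cancel (h'.symm.trans h))
  have S_add : ∀ u v, S (u + v) = S u + S v := fun u v =>
    S_eq _ _ (c u + c v) (by
      conv_lhs => rw [hS u, hS v]
      rw [map_add]; ring)
  -- The twisted Leibniz rule for `S` is what makes the expansion multiplicative.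
  have S_mul : ∀ u v, S (u * v) = c u • S v + S u * v := fun u v =>
    S_eq _ _ (c u * c v) (by
      rw [Algebra.smul_def, map_mul]
      linear_combination (algebraMap k V (c u)) * hS v + v * hS u)
  have S_alg : ∀ a, S (algebraMap k V a) = 0 := fun a => S_eq _ 0 a (by simp)
  let G : V → k⟦X⟧ := fun v => PowerSeries.mk fun n => c (S^[n] v)
  have G_zero : ∀ v, coeff 0 (G v) = c v := fun v => by simp [G]
  have G_succ : ∀ n v, coeff (n + 1) (G v) = coeff n (G (S v)) := fun n v => by
    simp [G]
  have G_rec : ∀ v, G v = C (c v) + X * G (S v) := by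
    intro v
    ext n
    cases n with
    | zero => rw [G_zero]; simp
    | succ n => rw [G_succ]; simp [coeff_succ_X_mul]
  have G_add : ∀ u v, G (u + v) = G u + G v := by
    intro u v
    ext n
    induction n generalizing u v with
    | zero => rw [map_add, G_zero, G_zero, G_zero, map_add]
    | succ n ih => rw [map_add, G_succ, G_succ, G_succ, S_add, ih, map_add]
  have G_alg : ∀ a, G (algebraMap k V a) = C a := by
    have h0 : G 0 = 0 := by simpa using G_add 0 0
    intro a
    rw [G_rec, S_alg, h0]; simp
  have G_smul : ∀ (a : k) (v : V), G (a • v) = a • G v := by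
    intro a v
    have hS' : ∀ v, S (a • v) = a • S v := fun v => by
      rw [Algebra.smul_def, S_mul, S_alg]; simp
    ext n
    induction n generalizing v with
    | zero => rw [coeff_smul, G_zero, G_zero, map_smul, smul_eq_mul]
    | succ n ih => rw [coeff_smul, G_succ, G_succ, hS', ih, coeff_smul]
  have G_mul : ∀ u v, G (u * v) = G u * G v := by
    intro u v
    ext n
    induction n generalizing u v with
    | zero =>
      simp only [coeff_zero_eq_constantCoeff_apply, map_mul] at G_zero ⊢
      rw [G_zero, G_zero, G_zero, map_mul]
    | succ n ih =>
      rw [G_succ, S_mul, G_add, map_add, ih, G_smul, G_rec u, add_mul, map_add, mul_assoc,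
        coeff_succ_X_mul, coeff_smul, coeff_C_mul, G_succ, smul_eq_mul]
  let F : V →ₐ[k] k⟦X⟧ :=
    { toFun := G
      map_one' := by simpa using G_alg 1
      map_mul' := G_mul
      map_zero' := by simpa using G_alg 0
      map_add' := G_add
      commutes' := G_alg }
  refine ⟨F, ?_⟩
  have h1 : S π = 1 := S_eq _ _ 0 (by simp)
  change G π = X
  rw [G_rec, h1, hcπ, show G 1 = 1 by simpa using G_alg 1]
  simp

open PowerSeries in
/-- A `k⟦X⟧`-algebra that is `X`-adically separated and finite-dimensional modulo `X` is finite
over `k⟦X⟧`. With `b i` lifting generators modulo `φ X`, write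
`a = ∑ i, ℓ a i • b i + φ X * S a`; iterating `S` yields power series coefficients expressing `a`
in terms of the `b i`. -/
theorem PowerSeries.finite_of_finite_quotient_X {k A : Type*} [Field k] [CommRing A] [Algebra k A]
    (φ : k⟦X⟧ →ₐ[k] A) [Module.Finite k (A ⧸ Ideal.span {φ X})]
    (hsep : ⨅ n : ℕ, Ideal.span {φ X} ^ n = ⊥) : φ.toRingHom.Finite := by
  obtain ⟨d, e, he⟩ := Module.Finite.exists_fin (R := k) (M := A ⧸ Ideal.span {φ X})
  choose b hb using fun i => Ideal.Quotient.mk_surjective (e i)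
  have h : ∀ a : A, ∃ (ℓ : Fin d → k) (w : A), a = ∑ i, ℓ i • b i + φ X * w := by
    intro a
    have ha : Ideal.Quotient.mk (Ideal.span {φ X}) a ∈ Submodule.span k (Set.range e) := by
      rw [he]; trivial
    obtain ⟨ℓ, hℓ⟩ := (Submodule.mem_span_range_iff_exists_fun k).1 ha
    have : a - ∑ i, ℓ i • b i ∈ Ideal.span {φ X} := by
      rw [← Ideal.Quotient.eq, ← hℓ, ← Ideal.Quotient.mkₐ_eq_mk k, map_sum]
      simp only [map_smul]
      simp only [Ideal.Quotient.mkₐ_eq_mk, hb]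
    obtain ⟨w, hw⟩ := Ideal.mem_span_singleton.1 this
    exact ⟨ℓ, w, by rw [← hw]; ring⟩
  choose ℓ S hS using h
  let G : Fin d → A → k⟦X⟧ := fun i a => PowerSeries.mk fun n => ℓ (S^[n] a) i
  have G_rec : ∀ i a, G i a = C (ℓ a i) + X * G i (S a) := by
    intro i a
    ext n
    cases n with
    | zero => simp [G]
    | succ n => simp [G, coeff_succ_X_mul]
  let D : A → A := fun a => a - ∑ i, φ (G i a) * b i
  have D_rec : ∀ a, D a = φ X * D (S a) := by
    intro a
    have h1 : ∀ i, φ (G i a) * b i = ℓ a i • b i + φ X * (φ (G i (S a)) * b i) := by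
      intro i
      rw [G_rec, map_add, map_mul, ← algebraMap_eq, AlgHom.commutes, Algebra.smul_def]; ring
    simp only [D, h1, Finset.sum_add_distrib, ← Finset.mul_sum]
    linear_combination hS a
  have D_mem : ∀ n a, D a ∈ Ideal.span {φ X} ^ n := by
    intro n
    induction n with
    | zero => simp
    | succ n ih =>
      intro a
      rw [D_rec, pow_succ']
      exact Ideal.mul_mem_mul (Ideal.mem_span_singleton_self _) (ih _)
  have D_zero : ∀ a, D a = 0 := fun a => by
    rw [← Ideal.mem_bot, ← hsep]
    exact Ideal.mem_iInf.2 fun n => D_mem n a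
  classical
  let := φ.toRingHom.toAlgebra
  refine ⟨⟨Finset.univ.image b, ?_⟩⟩
  rw [eq_top_iff]
  rintro a -
  rw [sub_eq_zero.1 (D_zero a)]
  refine Submodule.sum_mem _ fun i _ => ?_
  exact Submodule.smul_mem _ (G i a) (Submodule.subset_span (by simp))

/-! ### Ideals maximal among those of infinite codimension -/

/-- The exact sequence `R ⧸ J₁ → R ⧸ P → R ⧸ J₂ → 0` whose first map is multiplication by `a`, where
`a J₁ ⊆ P` and `J₂ = (a) + P`. -/
theorem Ideal.finite_quotient_of_mul_mem {k R : Type*} [Field k] [CommRing R] [Algebra k R]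
    {P J₁ J₂ : Ideal R} {a : R} (h₁ : ∀ x ∈ J₁, a * x ∈ P) (hP : P ≤ J₂) (ha : a ∈ J₂)
    (h₂ : J₂ ≤ Ideal.span {a} ⊔ P) [Module.Finite k (R ⧸ J₁)] [Module.Finite k (R ⧸ J₂)] :
    Module.Finite k (R ⧸ P) := by
  let f : (R ⧸ J₁) →ₗ[k] (R ⧸ P) :=
    (Submodule.mapQ J₁ P (LinearMap.mulLeft R a) h₁).restrictScalars k
  let g : (R ⧸ P) →ₗ[k] (R ⧸ J₂) := (Ideal.Quotient.factorₐ k hP).toLinearMap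
  refine Module.Finite.of_exact (f := f) (g := g) ?_ (Ideal.Quotient.factor_surjective hP)
  rw [LinearMap.exact_iff]
  refine le_antisymm ?_ ?_
  · intro y hy
    obtain ⟨y, rfl⟩ := Ideal.Quotient.mk_surjective y
    have hy' : Ideal.Quotient.mk J₂ y = 0 := hy
    obtain ⟨r, p, hp, hr⟩ := Ideal.mem_span_singleton_sup.1
      (h₂ (Ideal.Quotient.eq_zero_iff_mem.1 hy'))
    refine ⟨Ideal.Quotient.mk J₁ r, ?_⟩
    change Ideal.Quotient.mk P (a * r) = _
    rw [Ideal.Quotient.eq, ← hr]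
    convert P.neg_mem hp using 1
    ring
  · rintro _ ⟨x, rfl⟩
    obtain ⟨x, rfl⟩ := Ideal.Quotient.mk_surjective x
    change Ideal.Quotient.mk J₂ (a * x) = 0
    exact Ideal.Quotient.eq_zero_iff_mem.2 (J₂.mul_mem_right x ha)

/-- In a Noetherian `k`-algebra, an ideal that is maximal among the ideals of infinite codimension
is prime. -/
theorem Ideal.exists_isPrime_maximal_infinite_quotient (k : Type*) {R : Type*} [Field k] [CommRing R]
    [IsNoetherianRing R] [Algebra k R] (I : Ideal R) (hI : ¬ Module.Finite k (R ⧸ I)) :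
    ∃ P : Ideal R, I ≤ P ∧ P.IsPrime ∧ ¬ Module.Finite k (R ⧸ P) ∧
      ∀ J : Ideal R, P < J → Module.Finite k (R ⧸ J) := by
  obtain ⟨P, ⟨hIP, hP⟩, hmax⟩ := set_has_maximal_iff_noetherian.2 ‹IsNoetherianRing R›
    {J : Ideal R | I ≤ J ∧ ¬ Module.Finite k (R ⧸ J)} ⟨I, le_rfl, hI⟩
  have hfin : ∀ J : Ideal R, P < J → Module.Finite k (R ⧸ J) := fun J hJ => by
    by_contra h
    exact hmax J ⟨hIP.trans hJ.le, h⟩ hJ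
  refine ⟨P, hIP, ⟨?_, ?_⟩, hP, hfin⟩
  · rintro rfl
    exact hP inferInstance
  · intro a b hab
    by_contra! hn
    have lt : ∀ c, c ∉ P → P < P ⊔ Ideal.span {c} := fun c hc =>
      lt_of_le_of_ne le_sup_left fun h =>
        hc (h ▸ Ideal.mem_sup_right (Ideal.mem_span_singleton_self c))
    have := hfin _ (lt a hn.1)
    have := hfin _ (lt b hn.2)
    refine hP (Ideal.finite_quotient_of_mul_mem (a := a) (J₁ := P ⊔ Ideal.span {b})
      (J₂ := P ⊔ Ideal.span {a}) ?_ le_sup_left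
      (Ideal.mem_sup_right (Ideal.mem_span_singleton_self a)) (sup_comm _ _).le)
    have hle : P ⊔ Ideal.span {b} ≤ P.comap (LinearMap.mulLeft R a) := by
      refine sup_le (fun x hx => Ideal.mul_mem_left P a hx) ?_
      rw [Ideal.span_singleton_le_iff_mem]
      exact hab
    exact fun x hx => hle hx

/-! ### Maps from one-dimensional domains to `k⟦X⟧` -/

open PowerSeries in
/-- Modulo an ideal containing `X`, the ring `k⟦X⟧` acts through `constantCoeff`, so an integral
equation over `k⟦X⟧` becomes one over `k`. -/
theorem PowerSeries.isIntegral_quotient_of_X_mem {k B : Type*} [Field k] [CommRing B] [Algebra k B]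
    [Algebra k⟦X⟧ B] [IsScalarTower k k⟦X⟧ B] [Algebra.IsIntegral k⟦X⟧ B] (M : Ideal B)
    (hX : algebraMap k⟦X⟧ B X ∈ M) : Algebra.IsIntegral k (B ⧸ M) := by
  have hfac : algebraMap k⟦X⟧ (B ⧸ M) = (algebraMap k (B ⧸ M)).comp constantCoeff := by
    ext f
    have hf : f - C (constantCoeff f) ∈ Ideal.span {(X : k⟦X⟧)} := by
      rw [Ideal.mem_span_singleton, X_dvd_iff]; simp
    obtain ⟨g, hg⟩ := Ideal.mem_span_singleton.1 hf
    rw [RingHom.comp_apply, IsScalarTower.algebraMap_apply k k⟦X⟧ (B ⧸ M), ← sub_eq_zero,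
      ← map_sub, algebraMap_eq, hg, map_mul,
      IsScalarTower.algebraMap_apply k⟦X⟧ B (B ⧸ M) X, Ideal.Quotient.algebraMap_eq,
      Ideal.Quotient.eq_zero_iff_mem.2 hX, zero_mul]
  refine ⟨fun b => ?_⟩
  obtain ⟨p, hp, hpb⟩ := Algebra.IsIntegral.isIntegral (R := k⟦X⟧) b
  refine ⟨p.map constantCoeff, hp.map _, ?_⟩
  rw [Polynomial.eval₂_map, ← hfac]
  exact hpb

open PowerSeries in
/-- The localization of `B` at a maximal ideal is a discrete valuation ring with residue field `k`,
and expanding in a uniformizer embeds it in `k⟦X⟧`. -/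
theorem PowerSeries.exists_algHom_of_isDedekindDomain {k B : Type*} [Field k] [IsAlgClosed k] [CommRing B]
    [IsDedekindDomain B] [Algebra k B]
    [Algebra k⟦X⟧ B] [IsScalarTower k k⟦X⟧ B] [Algebra.IsIntegral k⟦X⟧ B]
    (hinj : algebraMap k⟦X⟧ B X ≠ 0) :
    ∃ F : B →ₐ[k] k⟦X⟧, F (algebraMap k⟦X⟧ B X) ≠ 0 := by
  obtain ⟨M, hM⟩ := Ideal.exists_maximal B
  -- `M` lies over the maximal ideal `(X)` because `B` is integral over `k⟦X⟧`.
  have hX : algebraMap k⟦X⟧ B X ∈ M := by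
    have h := IsLocalRing.eq_maximalIdeal
      (Ideal.isMaximal_comap_of_isIntegral_of_isMaximal (R := k⟦X⟧) M)
    rw [← Ideal.mem_comap, h, maximalIdeal_eq_span_X]
    exact Ideal.mem_span_singleton_self _
  have hM0 : M ≠ ⊥ := by
    rintro rfl
    exact hinj (by simpa using hX)
  have := isIntegral_quotient_of_X_mem (k := k) M hX
  let V := Localization.AtPrime M
  have : IsDiscreteValuationRing V :=
    IsLocalization.AtPrime.isDiscreteValuationRing_of_dedekind_domain B hM0 V
  have hbij : Function.Bijective (algebraMap k (IsLocalRing.ResidueField V)) := by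
    have h1 := IsAlgClosed.algebraMap_bijective_of_isIntegral (k := k) (K := B ⧸ M)
    have h2 := M.bijective_algebraMap_quotient_residueField
    have : (algebraMap k (IsLocalRing.ResidueField V) : k → _) =
       algebraMap (B ⧸ M) M.ResidueField ∘ algebraMap k (B ⧸ M) := by
      ext x
      exact IsScalarTower.algebraMap_apply k (B ⧸ M) M.ResidueField x
    rw [this]
    exact h2.comp h1
  let e := AlgEquiv.ofBijective (Algebra.ofId k (IsLocalRing.ResidueField V)) hbij
  let c : V →ₐ[k] k := (e.symm : _ →ₐ[k] k).comp
    (IsScalarTower.toAlgHom k V (IsLocalRing.ResidueField V))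
  obtain ⟨π, hπ⟩ := IsDiscreteValuationRing.exists_irreducible V
  have hc : RingHom.ker c = Ideal.span {π} := by
    rw [← hπ.maximalIdeal_eq]
    ext v
    simp [c, RingHom.mem_ker]
  obtain ⟨F, hF⟩ := exists_algHom_of_ker_eq_span c hπ.ne_zero hc
  have hx : algebraMap B V (algebraMap k⟦X⟧ B X) ≠ 0 := by
    rwa [Ne, map_eq_zero_iff _ (IsLocalization.injective V M.primeCompl_le_nonZeroDivisors)]
  refine ⟨F.comp (IsScalarTower.toAlgHom k B V), ?_⟩
  obtain ⟨n, u, hu⟩ := IsDiscreteValuationRing.eq_unit_mul_pow_irreducible hx hπ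
  simp only [AlgHom.comp_apply, IsScalarTower.coe_toAlgHom']
  rw [hu, map_mul, map_pow, hF]
  exact mul_ne_zero ((u.isUnit.map F).ne_zero) (pow_ne_zero _ X_ne_zero)

open PowerSeries in
/-- The homomorphism is constructed on the normalization of `A`, realized as the integral closure of
`k⟦X⟧` in the fraction field of `A`. Characteristic zero makes the extension of fraction fields
separable, so that this integral closure is a Dedekind domain. -/
theorem PowerSeries.exists_algHom_of_finite {k A : Type*} [Field k] [IsAlgClosed k] [CharZero k]
    [CommRing A] [IsDomain A] [Algebra k A]
    [Algebra k⟦X⟧ A] [IsScalarTower k k⟦X⟧ A] [Module.Finite k⟦X⟧ A] [FaithfulSMul k⟦X⟧ A] :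
    ∃ F : A →ₐ[k] k⟦X⟧, F (algebraMap k⟦X⟧ A X) ≠ 0 := by
  let K := FractionRing k⟦X⟧
  let L := FractionRing A
  let : Algebra K L := FractionRing.liftAlgebra k⟦X⟧ L
  have : CharZero k⟦X⟧ := charZero_of_injective_algebraMap
    (FaithfulSMul.algebraMap_injective k k⟦X⟧)
  have : CharZero K := charZero_of_injective_algebraMap (IsFractionRing.injective k⟦X⟧ K)
  let B := integralClosure k⟦X⟧ L
  have hne : algebraMap k⟦X⟧ B X ≠ 0 := by
    intro h
    have h' : algebraMap k⟦X⟧ L X = 0 := congrArg Subtype.val h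
    rw [IsScalarTower.algebraMap_apply k⟦X⟧ A L, FaithfulSMul.algebraMap_eq_zero_iff,
      FaithfulSMul.algebraMap_eq_zero_iff] at h'
    exact X_ne_zero h'
  obtain ⟨F, hF⟩ := exists_algHom_of_isDedekindDomain (k := k) hne
  let g : A →ₐ[k⟦X⟧] B := (IsScalarTower.toAlgHom k⟦X⟧ A L).codRestrict B fun a =>
    (Algebra.IsIntegral.isIntegral a).map _
  refine ⟨F.comp (g.restrictScalars k), ?_⟩
  simpa using hF

/-! ### Homomorphisms out of multivariate power series rings -/

/-- The variables generate the ideal of power series without constant term. -/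
theorem MvPowerSeries.exists_eq_C_add_sum_X_mul {σ k : Type*} [Fintype σ] [CommRing k]
    (f : MvPowerSeries σ k) : ∃ g : σ → MvPowerSeries σ k,
    f = MvPowerSeries.C (MvPowerSeries.constantCoeff f) + ∑ i, MvPowerSeries.X i * g i := by
  classical
  -- Split off the multiples of one variable at a time; the remainder `h` involves none of the
  -- variables treated so far.
  have key : ∀ s : Finset σ, ∃ (g : σ → MvPowerSeries σ k) (h : MvPowerSeries σ k),
      f = h + ∑ i ∈ s, MvPowerSeries.X i * g i ∧
      MvPowerSeries.constantCoeff h = MvPowerSeries.constantCoeff f ∧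
      ∀ i ∈ s, ∀ d : σ →₀ ℕ, d i ≠ 0 → MvPowerSeries.coeff d h = 0 := by
    intro s
    induction s using Finset.induction_on with
    | empty => exact ⟨0, f, by simp⟩
    | insert j s hj ih =>
      obtain ⟨g, h, hf, hh, hd⟩ := ih
      let h' : MvPowerSeries σ k := fun d => if d j = 0 then MvPowerSeries.coeff d h else 0
      have hh' : ∀ d, MvPowerSeries.coeff d h' = if d j = 0 then MvPowerSeries.coeff d h else 0 :=
        fun d => rfl
      have hdvd : MvPowerSeries.X j ∣ h - h' := by
        rw [MvPowerSeries.X_dvd_iff]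
        intro m hm
        rw [map_sub, hh', if_pos hm, sub_self]
      obtain ⟨w, hw⟩ := hdvd
      refine ⟨Function.update g j w, h', ?_, ?_, ?_⟩
      · rw [Finset.sum_insert hj, Function.update_self, ← hw,
          Finset.sum_congr rfl fun i hi => by
            rw [Function.update_of_ne (ne_of_mem_of_not_mem hi hj)]]
        rw [← add_assoc, add_sub_cancel, ← hf]
      · rw [← MvPowerSeries.coeff_zero_eq_constantCoeff_apply, hh',
          if_pos (by simp), MvPowerSeries.coeff_zero_eq_constantCoeff_apply, hh]
      · intro i hi d hdi
        rw [hh']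
        rcases Finset.mem_insert.1 hi with rfl | hi
        · rw [if_neg hdi]
        · rw [hd i hi d hdi, ite_self]
  obtain ⟨g, h, hf, hh, hd⟩ := key Finset.univ
  refine ⟨g, ?_⟩
  have : h = MvPowerSeries.C (MvPowerSeries.constantCoeff f) := by
    ext d
    by_cases h0 : d = 0
    · subst h0; simpa using hh
    · obtain ⟨i, hi⟩ := Finsupp.ne_iff.1 h0
      rw [hd i (Finset.mem_univ i) d hi, MvPowerSeries.coeff_C, if_neg h0]
  rw [← this]
  exact hf

open PowerSeries in
/-- `k`-algebra homomorphisms to `k⟦X⟧` are local: `f - a` is a unit for every nonzero scalar `a`, so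
`ψ f` cannot have the constant coefficient `a`. -/
theorem MvPowerSeries.constantCoeff_algHom_apply {σ k : Type*} [Field k]
    (ψ : MvPowerSeries σ k →ₐ[k] k⟦X⟧) {f : MvPowerSeries σ k}
    (hf : MvPowerSeries.constantCoeff f = 0) : PowerSeries.constantCoeff (ψ f) = 0 := by
  by_contra hc
  have h1 : IsUnit (f - MvPowerSeries.C (PowerSeries.constantCoeff (ψ f))) := by
    rw [MvPowerSeries.isUnit_iff_constantCoeff]
    simpa [hf] using hc
  have h2 := (h1.map ψ).map (PowerSeries.constantCoeff (R := k))
  rw [map_sub, show ψ (MvPowerSeries.C _) = PowerSeries.C _ from ψ.commutes _] at h2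
  simp at h2

open PowerSeries in
/-- Automatic continuity: a `k`-algebra homomorphism to `k⟦X⟧` is determined by the images of the
variables, with no topological assumption. -/
theorem MvPowerSeries.algHom_powerSeries_ext {σ k : Type*} [Fintype σ] [Field k]
    {ψ₁ ψ₂ : MvPowerSeries σ k →ₐ[k] k⟦X⟧}
    (h : ∀ i, ψ₁ (MvPowerSeries.X i) = ψ₂ (MvPowerSeries.X i)) : ψ₁ = ψ₂ := by
  -- Writing `f = c + ∑ X i * g i`, the difference at `f` is a combination of the differences at
  -- the `g i` with coefficients divisible by `X`.
  have key : ∀ n f, (PowerSeries.X : k⟦X⟧) ^ n ∣ ψ₁ f - ψ₂ f := by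
    intro n
    induction n with
    | zero => simp
    | succ n ih =>
      intro f
      obtain ⟨g, hg⟩ := MvPowerSeries.exists_eq_C_add_sum_X_mul f
      have hC : ∀ ψ : MvPowerSeries σ k →ₐ[k] k⟦X⟧, ∀ a, ψ (MvPowerSeries.C a) = PowerSeries.C a :=
        fun ψ a => ψ.commutes a
      have : ψ₁ f - ψ₂ f = ∑ i, ψ₁ (MvPowerSeries.X i) * (ψ₁ (g i) - ψ₂ (g i)) := by
        rw [hg]
        simp only [map_add, map_sum, map_mul, hC, h, mul_sub, Finset.sum_sub_distrib]
        ring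
      rw [this]
      refine Finset.dvd_sum fun i _ => ?_
      rw [pow_succ']
      refine mul_dvd_mul
        (PowerSeries.X_dvd_iff.2 (MvPowerSeries.constantCoeff_algHom_apply _ ?_)) (ih _)
      simp
  ext f n
  have := PowerSeries.X_pow_dvd_iff.1 (key (n + 1) f) n n.lt_succ_self
  rwa [map_sub, sub_eq_zero] at this

/-! ### The curve -/

/-- If `P` is a prime of infinite codimension but every larger ideal has finite codimension, the
domain `R ⧸ P` maps to `k⟦X⟧` so that some `t` without constant term has nonzero image. -/
theorem MvPowerSeries.exists_algHom_powerSeries_of_isPrime {σ k : Type*} [Finite σ] [Field k]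
    [IsAlgClosed k] [CharZero k] {P : Ideal (MvPowerSeries σ k)} [P.IsPrime]
    (hP : ¬ Module.Finite k (MvPowerSeries σ k ⧸ P))
    (hmax : ∀ J : Ideal (MvPowerSeries σ k), P < J → Module.Finite k (MvPowerSeries σ k ⧸ J)) :
    ∃ ψ : MvPowerSeries σ k →ₐ[k] PowerSeries k, (∀ f ∈ P, ψ f = 0) ∧
      ∃ t, MvPowerSeries.constantCoeff t = 0 ∧ ψ t ≠ 0 := by
  -- Otherwise `P` contains the ideal of all series without constant term, of codimension one.
  obtain ⟨t, ht, htP⟩ : ∃ t : MvPowerSeries σ k, MvPowerSeries.constantCoeff t = 0 ∧ t ∉ P := by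
    by_contra! h
    refine hP (Module.Finite.of_surjective (Algebra.linearMap k _) fun a => ?_)
    obtain ⟨f, rfl⟩ := Ideal.Quotient.mk_surjective a
    refine ⟨MvPowerSeries.constantCoeff f, ?_⟩
    change Ideal.Quotient.mk P (MvPowerSeries.C _) = _
    exact (Ideal.Quotient.eq.2 (h _ (by simp))).symm
  -- `R ⧸ P` becomes a finite torsion-free `k⟦X⟧`-algebra by letting `X` act as `t`.
  let φ : PowerSeries k →ₐ[k] MvPowerSeries σ k ⧸ P :=
    (Ideal.Quotient.mkₐ k P).comp
      (PowerSeries.substAlgHom (PowerSeries.HasSubst.of_constantCoeff_zero ht))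
  have hφX : φ PowerSeries.X = Ideal.Quotient.mk P t := by
    simp [φ, PowerSeries.substAlgHom_X]
  have ht0 : φ PowerSeries.X ≠ 0 := by
    rwa [hφX, Ne, Ideal.Quotient.eq_zero_iff_mem]
  -- A nonzero power series is a unit times a power of `X`, and `φ X` is a nonzero element of a
  -- domain.
  have hinj : Function.Injective φ := by
    refine (injective_iff_map_eq_zero φ).2 fun f hf => ?_
    by_contra hf0
    obtain ⟨n, u, rfl⟩ :=
      IsDiscreteValuationRing.eq_unit_mul_pow_irreducible hf0 PowerSeries.X_prime.irreducible
    rw [map_mul, map_pow] at hf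
    exact mul_ne_zero (u.isUnit.map φ).ne_zero (pow_ne_zero n ht0) hf
  have hne : Ideal.span {φ PowerSeries.X} ≠ ⊤ := by
    rw [Ne, Ideal.span_singleton_eq_top, hφX]
    intro hu
    obtain ⟨a, ha⟩ := hu.exists_right_inv
    obtain ⟨r, rfl⟩ := Ideal.Quotient.mk_surjective a
    rw [← map_mul, ← map_one (Ideal.Quotient.mk P), Ideal.Quotient.eq] at ha
    refine Ideal.IsPrime.ne_top ‹P.IsPrime› (Ideal.eq_top_of_isUnit_mem P ha ?_)
    rw [MvPowerSeries.isUnit_iff_constantCoeff]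
    simp [ht]
  have : Module.Finite k ((MvPowerSeries σ k ⧸ P) ⧸ Ideal.span {φ PowerSeries.X}) := by
    have := hmax ((Ideal.span {φ PowerSeries.X}).comap (Ideal.Quotient.mkₐ k P)) <| by
      refine lt_of_le_of_ne (fun x hx => ?_) fun h => htP ?_
      · rw [Ideal.mem_comap, Ideal.Quotient.mkₐ_eq_mk, Ideal.Quotient.eq_zero_iff_mem.2 hx]
        exact zero_mem _
      · rw [h, Ideal.mem_comap, Ideal.Quotient.mkₐ_eq_mk, hφX]
        exact Ideal.mem_span_singleton_self _
    refine Module.Finite.of_surjective (Ideal.quotientMapₐ (Ideal.span {φ PowerSeries.X})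
      (Ideal.Quotient.mkₐ k P) le_rfl).toLinearMap
      (Ideal.quotientMap_surjective (H := le_rfl) (Ideal.Quotient.mkₐ_surjective k P))
  have hfin := PowerSeries.finite_of_finite_quotient_X φ (Ideal.iInf_pow_eq_bot_of_isDomain _ hne)
  let := φ.toRingHom.toAlgebra
  have : IsScalarTower k (PowerSeries k) (MvPowerSeries σ k ⧸ P) :=
    .of_algebraMap_eq fun a => (φ.commutes a).symm
  have : Module.Finite (PowerSeries k) (MvPowerSeries σ k ⧸ P) := hfin
  have : FaithfulSMul (PowerSeries k) (MvPowerSeries σ k ⧸ P) :=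
    (faithfulSMul_iff_algebraMap_injective _ _).2 hinj
  obtain ⟨F, hF⟩ := PowerSeries.exists_algHom_of_finite (k := k) (A := MvPowerSeries σ k ⧸ P)
  refine ⟨F.comp (Ideal.Quotient.mkₐ k P), fun f hf => ?_, t, ht, ?_⟩
  · rw [AlgHom.comp_apply, Ideal.Quotient.mkₐ_eq_mk, Ideal.Quotient.eq_zero_iff_mem.2 hf, map_zero]
  · rw [AlgHom.comp_apply, Ideal.Quotient.mkₐ_eq_mk, ← hφX]
    exact hF

theorem theorem3 (n : ℕ) (I : Ideal (MvPowerSeries (Fin n) ℂ))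
    (hI : ¬ FiniteDimensional ℂ (MvPowerSeries (Fin n) ℂ ⧸ I)) :
    ∃ ζ : FormalCurve n, ζ.PassesThrough 0 ∧ ¬ ζ.IsConstant ∧
      ∀ f ∈ I, (ζ.pullback f).order = ⊤ := by
  obtain ⟨P, hIP, hPprime, hP, hmax⟩ := Ideal.exists_isPrime_maximal_infinite_quotient ℂ I hI
  obtain ⟨ψ, hψP, t, ht, hψt⟩ := MvPowerSeries.exists_algHom_powerSeries_of_isPrime hP hmax
  let ζ : FormalCurve n := fun j => ψ (MvPowerSeries.X j)
  have hζ : ∀ j, PowerSeries.constantCoeff (ζ j) = 0 := fun j =>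
    MvPowerSeries.constantCoeff_algHom_apply ψ (MvPowerSeries.constantCoeff_X j)
  have hsubst : MvPowerSeries.HasSubst (τ := Unit) (S := ℂ) ζ :=
    MvPowerSeries.hasSubst_of_constantCoeff_zero hζ
  have hψ : ψ = MvPowerSeries.substAlgHom hsubst :=
    MvPowerSeries.algHom_powerSeries_ext fun j => (MvPowerSeries.substAlgHom_X hsubst j).symm
  refine ⟨ζ, hζ, ?_, fun f hf => ?_⟩
  · rintro ⟨p, hp⟩
    -- A constant curve through the origin is zero, and then `ψ` kills all series without constant
    -- term, among them `t`.
    have h0 : ∀ j, ψ (MvPowerSeries.X j) = 0 := fun j => by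
      have h := hζ j
      rw [hp j, PowerSeries.constantCoeff_C] at h
      change ζ j = 0
      rw [hp j, h, map_zero]
    obtain ⟨g, hg⟩ := MvPowerSeries.exists_eq_C_add_sum_X_mul t
    refine hψt ?_
    rw [hg, ht]
    simp [h0]
  · rw [PowerSeries.order_eq_top]
    have h : ψ f = ζ.pullback f := by
      rw [hψ, MvPowerSeries.substAlgHom_apply]; rfl
    rw [← h]
    exact hψP f (hIP hf)
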